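/- All topological spaces are Hausdorff. A semigroup $S$ is \emph{inverse} if for every $x\in S$ there is exactly one $x^{-1}\in S$ with $xx^{-1}x=x$ and $x^{-1}xx^{-1}=x^{-1}$; a \emph{topological inverse semigroup} is an inverse semigroup with a topology for which multiplication (jointly) and inversion $x\mapsto x^{-1}$ are continuous. The \emph{extended bicyclic semigroup} $\mathscr{C}_{\mathbb{Z}}$ is the set $\mathbb{Z}\times\mathbb{Z}$ with the operation $$(a,b)\cdot(c,d)=\begin{cases}(a-b+c,\,d),& b<c,\\ (a,\,d),& b=c,\\ (a,\,d+b-c),& b>c.\end{cases}$$ Given a strictly decreasing sequence $(m_i)_{i\in\mathbb{N}}$ of negative integers, define the following topological semigroups. (1) $S_1=\mathscr{C}_{\mathbb{Z}}\sqcup\{e_1\}$ is $\mathscr{C}_{\mathbb{Z}}$ with an adjoined unit $e_1$. In the topology $\tau_1$ all points of $\mathscr{C}_{\mathbb{Z}}$ are isolated, and the sets $\{e_1\}\cup\{(m_i,m_i) : i\ge n\}$, $n\in\mathbb{N}$, form a base at $e_1$. (2) $S_3=\mathscr{C}_{\mathbb{Z}}\sqcup\mathbb{Z}$, where $\mathbb{Z}$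 carries addition, $\mathscr{C}_{\mathbb{Z}}$ its own operation, and $(a,b)\cdot k=k\cdot(a,b)=k+b-a\in\mathbb{Z}$ for $(a,b)\in\mathscr{C}_{\mathbb{Z}}$, $k\in\mathbb{Z}$. In the topology $\tau_3$ all points of $\mathscr{C}_{\mathbb{Z}}$ are isolated, and a base at $k\in\mathbb{Z}$ is formed by the sets $U_n(k)$, $n=1,2,3,\dots$, where $U_n(k)=\{k\}\cup\{(a,a+k): a\ge n\}$ if $k\ge 0$ and $U_n(k)=\{k\}\cup\{(a-k,a): a\ge n\}$ if $k\le 0$. (3) $S_4=S_3\sqcup\{e_1\}$ is $S_3$ with an adjoined unit $e_1$, with the topology $\tau_4$ generated by $\tau_1\cup\tau_3$, where $S_1=\mathscr{C}_{\mathbb{Z}}\sqcup\{e_1\}$ and $S_3$ are regarded as subsets of $S_4$. \textbf{Corollary.} Let $T$ be a Hausdorff locally compact topological inverse semigroup which has an identity and contains (an isomorphic copy of) $\mathscr{C}_{\mathbb{Z}}$ as a dense subsemigroup, and suppose that the group of units of $T$ is a singleton. Then there exists a strictly decreasing sequence $(m_i)_{i\in\mathbb{N}}$ of negative integers such that $T$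 is topologically isomorphic (that is, isomorphic by a semigroup isomorphism that is a homeomorphism) either to $(S_1,\tau_1)$ or to $(S_4,\tau_4)$, where $\tau_1$ and $\tau_4$ are the topologies determined by this sequence. -/

import Mathlib

/-- `S` is an inverse semigroup: every `x` has exactly one `y` with `x y x = x` and `y x y = y`. -/
def IsInverseSemigroup (S : Type*) [Semigroup S] : Prop :=
  ∀ x : S, ∃! y : S, x * y * x = x ∧ y * x * y = y

/-- The inversion `x ↦ x⁻¹` of an inverse semigroup. -/
noncomputable def IsInverseSemigroup.inversion {S : Type*} [Semigroup S]
    (h : IsInverseSemigroup S) (x : S) : S :=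
  (h x).choose

/-- A topological inverse semigroup: an inverse semigroup whose multiplication is jointly
continuous and whose inversion is continuous (the Hausdorff property is stated separately). -/
structure IsTopologicalInverseSemigroup (S : Type*) [Semigroup S] [TopologicalSpace S] :
    Prop where
  continuous_mul : Continuous fun p : S × S => p.1 * p.2
  isInverse : IsInverseSemigroup S
  continuous_inversion : Continuous isInverse.inversion

/-- The underlying set `ℤ × ℤ` of the extended bicyclic semigroup. -/
@[ext]
structure ExtBicyclic : Type where
  fst : ℤ
  snd : ℤ

namespace ExtBicyclic

instance : Mul ExtBicyclic where
  mul x y :=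
    if x.snd < y.fst then ⟨x.fst - x.snd + y.fst, y.snd⟩
    else if x.snd = y.fst then ⟨x.fst, y.snd⟩
    else ⟨x.fst, y.snd + x.snd - y.fst⟩

theorem mul_def (x y : ExtBicyclic) :
    x * y = if x.snd < y.fst then ⟨x.fst - x.snd + y.fst, y.snd⟩
      else if x.snd = y.fst then ⟨x.fst, y.snd⟩
      else ⟨x.fst, y.snd + x.snd - y.fst⟩ := rfl

theorem fst_mul (x y : ExtBicyclic) : (x * y).fst = x.fst + max 0 (y.fst - x.snd) := by
  rw [mul_def]; split_ifs <;> simp only <;> omega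

theorem snd_mul (x y : ExtBicyclic) : (x * y).snd = y.snd + max 0 (x.snd - y.fst) := by
  rw [mul_def]; split_ifs <;> simp only <;> omega

instance : Semigroup ExtBicyclic where
  mul_assoc x y z := by
    ext <;> simp only [fst_mul, snd_mul] <;> omega

end ExtBicyclic

/-- The extended bicyclic semigroup with an adjoined unit. The parameter `m` only serves to
determine the topology below. -/
def S1 (_m : ℕ → ℤ) : Type := WithOne ExtBicyclic

namespace S1

variable {m : ℕ → ℤ}

instance : Monoid (S1 m) := inferInstanceAs (Monoid (WithOne ExtBicyclic))

/-- The inclusion of the extended bicyclic semigroup. -/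
def of (x : ExtBicyclic) : S1 m := (x : WithOne ExtBicyclic)

/-- The basic neighbourhood `{1} ∪ {(mᵢ, mᵢ) : i ≥ n}` of the unit. -/
def unitNhd (m : ℕ → ℤ) (n : ℕ) : Set (S1 m) :=
  {1} ∪ {x | ∃ i : ℕ, n ≤ i ∧ x = of ⟨m i, m i⟩}

/-- The topology in which the points of the extended bicyclic semigroup are isolated and the sets
`unitNhd m n` form a base at the unit. -/
instance : TopologicalSpace (S1 m) where
  IsOpen V := (1 : S1 m) ∈ V → ∃ n : ℕ, unitNhd m n ⊆ V
  isOpen_univ _ := ⟨0, Set.subset_univ _⟩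
  isOpen_inter U V hU hV h := by
    obtain ⟨a, ha⟩ := hU h.1
    obtain ⟨b, hb⟩ := hV h.2
    refine ⟨max a b, ?_⟩
    rintro x (hx | ⟨i, hi, hx⟩)
    · exact ⟨ha (Or.inl hx), hb (Or.inl hx)⟩
    · exact ⟨ha (Or.inr ⟨i, by omega, hx⟩), hb (Or.inr ⟨i, by omega, hx⟩)⟩
  isOpen_sUnion F hF := by
    rintro ⟨V, hV, h⟩
    obtain ⟨n, hn⟩ := hF V hV h
    exact ⟨n, hn.trans (Set.subset_sUnion_of_mem hV)⟩

end S1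

/-- The disjoint union of the extended bicyclic semigroup and the group of integers. -/
inductive S3 : Type where
  | of (x : ExtBicyclic) : S3
  | int (k : ℤ) : S3

namespace S3

instance : Mul S3 where
  mul
    | of x, of y => of (x * y)
    | of x, int k => int (k + x.snd - x.fst)
    | int k, of x => int (k + x.snd - x.fst)
    | int k, int l => int (k + l)

theorem of_mul_of (x y : ExtBicyclic) : of x * of y = of (x * y) := rfl
theorem of_mul_int (x : ExtBicyclic) (k : ℤ) : of x * int k = int (k + x.snd - x.fst) := rfl
theorem int_mul_of (x : ExtBicyclic) (k : ℤ) : int k * of x = int (k + x.snd - x.fst) := rfl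
theorem int_mul_int (k l : ℤ) : int k * int l = int (k + l) := rfl

instance : Semigroup S3 where
  mul_assoc x y z := by
    cases x <;> cases y <;> cases z <;>
      simp only [of_mul_of, of_mul_int, int_mul_of, int_mul_int, mul_assoc, int.injEq,
        ExtBicyclic.fst_mul, ExtBicyclic.snd_mul] <;> omega

/-- The basic neighbourhoods of the integer `k`: `{k} ∪ {(a, a + k) : a ≥ n}` if `k ≥ 0`, and
`{k} ∪ {(a - k, a) : a ≥ n}` if `k ≤ 0`. -/
def intNhd (n : ℕ) (k : ℤ) : Set S3 :=
  if 0 ≤ k then {int k} ∪ {x | ∃ a : ℤ, (n : ℤ) ≤ a ∧ x = of ⟨a, a + k⟩}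
  else {int k} ∪ {x | ∃ a : ℤ, (n : ℤ) ≤ a ∧ x = of ⟨a - k, a⟩}

theorem intNhd_anti {a b : ℕ} (h : a ≤ b) (k : ℤ) : intNhd b k ⊆ intNhd a k := by
  unfold intNhd
  split_ifs <;>
  · rintro x (hx | ⟨i, hi, hx⟩)
    · exact Or.inl hx
    · exact Or.inr ⟨i, by omega, hx⟩

/-- The topology in which the points of the extended bicyclic semigroup are isolated and the sets
`intNhd n k`, for positive integers `n`, form a base at the integer `k`. -/
instance : TopologicalSpace S3 where
  IsOpen V := ∀ k : ℤ, int k ∈ V → ∃ n : ℕ, 0 < n ∧ intNhd n k ⊆ V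
  isOpen_univ _ _ := ⟨1, one_pos, Set.subset_univ _⟩
  isOpen_inter U V hU hV k h := by
    obtain ⟨a, ha0, ha⟩ := hU k h.1
    obtain ⟨b, _, hb⟩ := hV k h.2
    exact ⟨max a b, by omega, Set.subset_inter ((intNhd_anti (le_max_left a b) k).trans ha)
      ((intNhd_anti (le_max_right a b) k).trans hb)⟩
  isOpen_sUnion F hF k := by
    rintro ⟨V, hV, h⟩
    obtain ⟨n, hn0, hn⟩ := hF V hV k h
    exact ⟨n, hn0, hn.trans (Set.subset_sUnion_of_mem hV)⟩

end S3

/-- The semigroup `S3` with an adjoined unit. The parameter `m` only serves to determine the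
topology below. -/
def S4 (_m : ℕ → ℤ) : Type := WithOne S3

namespace S4

variable {m : ℕ → ℤ}

instance : Monoid (S4 m) := inferInstanceAs (Monoid (WithOne S3))

/-- The inclusion of `S3`. -/
def ofS3 (x : S3) : S4 m := (x : WithOne S3)

/-- The inclusion of `S1 m`, which maps the unit to the unit. -/
def ofS1 : S1 m → S4 m :=
  fun x => WithOne.recOneCoe (motive := fun _ => S4 m) 1 (fun a => ofS3 (S3.of a)) x

/-- The topology generated by the union of the topologies of `S1 m` and `S3`, whose members are
regarded as subsets of `S4 m`. -/
instance : TopologicalSpace (S4 m) :=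
  TopologicalSpace.generateFrom
    ({V | ∃ U : Set (S1 m), IsOpen U ∧ V = ofS1 '' U} ∪
      {V | ∃ U : Set S3, IsOpen U ∧ V = ofS3 '' U})

end S4

/-! Write `e n` for `f ⟨n, n⟩`. Since `e m * e n = e (max m n)`, these idempotents form a chain that
descends as `n` grows.

Closed alternatives that hold on the dense copy hold on all of `T`. Hence each condition `e n * x =
x` is clopen (`isClopen_lower`). The differences of consecutive such sets, on the left and on the
right, cut out cells containing one point each, so the copy consists of isolated points. On at least
one side, any other point lies above every level or below every level. As `1` is a limit of the `e
n`, a point above every level on the left satisfies `x * i x = 1`. Mixed positions are impossible,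
so lying above on both sides makes `x` a unit, hence `1` (`classification`).

If some further point exists, there is an idempotent `z` below all the `e n`. It is central, and `{x
| z * x = x}` is a group with identity `z`, in which the image of `ℤ` under `elem` is dense. As for
monothetic locally compact groups, the crux is to exclude recurrence
(`exists_forall_mul_elem_notMem`). If positive powers always returned to a compact neighbourhood of
`z`, a row of the copy could be pushed right forever inside that compact set, although it meets the
row in finitely many points. So the group is a discrete copy of `ℤ`. A conjugation shifting `e n` to
`e (n + 1)` then shows that the `e n` converge to `z`, and multiplication by `f ⟨0, k⟩` gives the
neighbourhoods of the other integers.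

Near `1` there are only `1` and some `e n` with `n < 0`. The indices occurring in a small compact
neighbourhood of `1`, enumerated downwards, are the sequence `m`. -/

open Filter Topology

set_option linter.unusedSectionVars false

/-- `f` is an embedding of the extended bicyclic semigroup onto a dense subsemigroup of `T`, and
`i` is the continuous inversion of the inverse semigroup `T`. -/
structure IsDenseExtBicyclic {T : Type*} [Monoid T] [TopologicalSpace T]
    (f : ExtBicyclic →ₙ* T) (i : T → T) : Prop where
  mul_inv_mul : ∀ x, x * i x * x = x
  inv_mul_inv : ∀ x, i x * x * i x = i x
  eq_inv : ∀ x y, x * y * x = x → y * x * y = y → y = i x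
  continuous_inv : Continuous i
  injective : Function.Injective f
  dense : DenseRange f

namespace ExtBicyclic

theorem mk_mul_mk (a b c d : ℤ) :
    (⟨a, b⟩ * ⟨c, d⟩ : ExtBicyclic) = ⟨a + max 0 (c - b), d + max 0 (b - c)⟩ := by
  ext
  · rw [fst_mul]
  · rw [snd_mul]

end ExtBicyclic

/-! ### Inversion and idempotents by density -/

namespace IsDenseExtBicyclic

variable {T : Type*} [Monoid T] [TopologicalSpace T] [T2Space T] [ContinuousMul T]
  {f : ExtBicyclic →ₙ* T} {i : T → T}

theorem f_mul (a b c d : ℤ) :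
    f ⟨a, b⟩ * f ⟨c, d⟩ = f ⟨a + max 0 (c - b), d + max 0 (b - c)⟩ := by
  rw [← map_mul, ExtBicyclic.mk_mul_mk]

theorem f_inj (h : IsDenseExtBicyclic f i) {a b c d : ℤ} :
    f ⟨a, b⟩ = f ⟨c, d⟩ ↔ a = c ∧ b = d := by
  rw [h.injective.eq_iff, ExtBicyclic.ext_iff]

theorem inv_f (h : IsDenseExtBicyclic f i) (a b : ℤ) : i (f ⟨a, b⟩) = f ⟨b, a⟩ := by
  symm
  apply h.eq_inv <;> simp only [f_mul] <;> congr 2 <;> omega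

/-- A closed condition holds everywhere if it holds on the extended bicyclic semigroup. -/
theorem closed_induction (h : IsDenseExtBicyclic f i) {p : T → Prop} (hp : IsClosed {x | p x})
    (hf : ∀ a b, p (f ⟨a, b⟩)) (x : T) : p x :=
  h.dense.induction_on (p := p) x hp fun c => hf c.fst c.snd

/-- A nonempty open set meets the extended bicyclic semigroup. -/
theorem exists_mem_open (h : IsDenseExtBicyclic f i) {U : Set T} (hU : IsOpen U) {x : T}
    (hx : x ∈ U) : ∃ a b, f ⟨a, b⟩ ∈ U := by
  obtain ⟨c, hc⟩ := h.dense.exists_mem_open hU ⟨x, hx⟩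
  exact ⟨c.fst, c.snd, hc⟩

theorem inv_inv (h : IsDenseExtBicyclic f i) (x : T) : i (i x) = x := by
  symm
  exact h.eq_inv _ _ (h.inv_mul_inv x) (h.mul_inv_mul x)

theorem inv_mul (h : IsDenseExtBicyclic f i) (x y : T) : i (x * y) = i y * i x := by
  have hi := h.continuous_inv
  refine h.closed_induction (p := fun x => i (x * y) = i y * i x)
    (isClosed_eq (by fun_prop) (by fun_prop)) (fun a b => ?_) x
  refine h.closed_induction (p := fun y => i (f ⟨a, b⟩ * y) = i y * i (f ⟨a, b⟩))
    (isClosed_eq (by fun_prop) (by fun_prop)) (fun c d => ?_) y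
  simp only [f_mul, h.inv_f]

theorem inv_of_isIdempotentElem (h : IsDenseExtBicyclic f i) {x : T} (hx : x * x = x) :
    i x = x := by
  symm
  apply h.eq_inv <;> rw [hx, hx]

/-- Idempotents are limits of idempotents of the extended bicyclic semigroup. -/
theorem exists_idempotent_mem (h : IsDenseExtBicyclic f i) {U : Set T} (hU : IsOpen U) {x : T}
    (hx : x * x = x) (hxU : x ∈ U) : ∃ n, f ⟨n, n⟩ ∈ U := by
  have hi := h.continuous_inv
  -- The map `y ↦ y * i y` fixes idempotents and sends `f ⟨a, b⟩` to `f ⟨a, a⟩`.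
  have hV : IsOpen ((fun y => y * i y) ⁻¹' U) := hU.preimage (by fun_prop)
  obtain ⟨a, b, hab⟩ := h.exists_mem_open hV (x := x)
    (by simpa [h.inv_of_isIdempotentElem hx, hx] using hxU)
  refine ⟨a, ?_⟩
  simpa [h.inv_f, f_mul] using hab

/-- A closed condition holds at each idempotent if it holds at those of the extended bicyclic
semigroup. -/
theorem idempotent_induction (h : IsDenseExtBicyclic f i) {p : T → Prop}
    (hp : IsClosed {x | p x}) (hf : ∀ n, p (f ⟨n, n⟩)) {x : T} (hx : x * x = x) : p x := by
  by_contra hpx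
  obtain ⟨n, hn⟩ := h.exists_idempotent_mem hp.isOpen_compl hx hpx
  exact hn (hf n)

theorem idempotent_mul_self (h : IsDenseExtBicyclic f i) (x : T) :
    x * i x * (x * i x) = x * i x := by
  rw [← mul_assoc, h.mul_inv_mul]

/-! ### Clopen levels and isolated points -/

/-- On the copy, `x * i x` is some `f ⟨a, a⟩`, and either `n ≤ a` or `a ≤ n - 1`. Both alternatives
are closed conditions, so they cover `T`. They exclude each other, so each is the complement of the
other. -/
theorem isClopen_lower (h : IsDenseExtBicyclic f i) (n : ℤ) :
    IsClopen {x | f ⟨n, n⟩ * x = x} := by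
  have hi := h.continuous_inv
  refine ⟨isClosed_eq (by fun_prop) (by fun_prop), ?_⟩
  have hP : IsClosed {x | f ⟨n - 1, n - 1⟩ * (x * i x) = f ⟨n - 1, n - 1⟩} :=
    isClosed_eq (by fun_prop) (by fun_prop)
  have hD : IsClosed {x | f ⟨n, n⟩ * x = x} := isClosed_eq (by fun_prop) (by fun_prop)
  convert hP.isOpen_compl using 1
  ext x
  simp only [Set.mem_ofPred_eq, Set.mem_compl_iff]
  constructor
  · intro hx hx'
    have h1 : f ⟨n, n⟩ * (x * i x) = x * i x := by rw [← mul_assoc, hx]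
    have h2 : f ⟨n, n⟩ * f ⟨n - 1, n - 1⟩ = f ⟨n, n⟩ := by
      rw [f_mul]
      congr 2 <;> omega
    have h3 : x * i x = f ⟨n, n⟩ := by rw [← h1, ← h2, mul_assoc, hx']
    rw [h3, f_mul, h.f_inj] at hx'
    omega
  · refine fun hx => (h.closed_induction (p := fun x =>
      f ⟨n, n⟩ * x = x ∨ f ⟨n - 1, n - 1⟩ * (x * i x) = f ⟨n - 1, n - 1⟩)
      (hD.union hP) (fun a b => ?_) x).resolve_right hx
    simp only [h.inv_f, f_mul, h.f_inj]
    omega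

theorem mul_eq_self_iff (h : IsDenseExtBicyclic f i) (n : ℤ) (x : T) :
    x * f ⟨n, n⟩ = x ↔ f ⟨n, n⟩ * i x = i x := by
  constructor
  · intro hx
    conv_rhs => rw [← hx]
    rw [h.inv_mul, h.inv_f]
  · intro hx
    have := congrArg i hx
    rwa [h.inv_mul, h.inv_f, h.inv_inv] at this

theorem isClopen_lower' (h : IsDenseExtBicyclic f i) (n : ℤ) :
    IsClopen {x | x * f ⟨n, n⟩ = x} := by
  simp only [h.mul_eq_self_iff]
  exact (h.isClopen_lower n).preimage h.continuous_inv

/-- The cell without `f ⟨a, b⟩` is open and misses the dense copy, hence is empty. -/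
theorem eq_f_of_mem_cell (h : IsDenseExtBicyclic f i) {a b : ℤ} {x : T}
    (h1 : f ⟨a, a⟩ * x = x) (h2 : f ⟨a + 1, a + 1⟩ * x ≠ x) (h3 : x * f ⟨b, b⟩ = x)
    (h4 : x * f ⟨b + 1, b + 1⟩ ≠ x) : x = f ⟨a, b⟩ := by
  by_contra hx
  have hU : IsOpen ({x | f ⟨a, a⟩ * x = x} ∩ {x | f ⟨a + 1, a + 1⟩ * x = x}ᶜ ∩
      ({x | x * f ⟨b, b⟩ = x} ∩ {x | x * f ⟨b + 1, b + 1⟩ = x}ᶜ) ∩ {f ⟨a, b⟩}ᶜ) :=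
    (((h.isClopen_lower _).isOpen.inter (h.isClopen_lower _).compl.isOpen).inter
      ((h.isClopen_lower' _).isOpen.inter (h.isClopen_lower' _).compl.isOpen)).inter
      isOpen_compl_singleton
  obtain ⟨c, d, hcd⟩ := h.exists_mem_open hU (x := x) ⟨⟨⟨h1, h2⟩, h3, h4⟩, hx⟩
  simp only [Set.mem_inter_iff, Set.mem_ofPred_eq, Set.mem_compl_iff, Set.mem_singleton_iff, f_mul,
    h.f_inj] at hcd
  omega

theorem isOpen_singleton_f (h : IsDenseExtBicyclic f i) (c : ExtBicyclic) :
    IsOpen {f c} := by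
  obtain ⟨a, b⟩ := c
  have hU : IsOpen ({x | f ⟨a, a⟩ * x = x} ∩ {x | f ⟨a + 1, a + 1⟩ * x = x}ᶜ ∩
      ({x | x * f ⟨b, b⟩ = x} ∩ {x | x * f ⟨b + 1, b + 1⟩ = x}ᶜ)) :=
    ((h.isClopen_lower _).isOpen.inter (h.isClopen_lower _).compl.isOpen).inter
      ((h.isClopen_lower' _).isOpen.inter (h.isClopen_lower' _).compl.isOpen)
  convert hU
  ext x
  simp only [Set.mem_inter_iff, Set.mem_ofPred_eq, Set.mem_compl_iff, Set.mem_singleton_iff]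
  constructor
  · rintro rfl
    simp only [f_mul, h.f_inj]
    omega
  · rintro ⟨⟨h1, h2⟩, h3, h4⟩
    exact h.eq_f_of_mem_cell h1 h2 h3 h4

theorem finite_of_isCompact (h : IsDenseExtBicyclic f i) {K : Set T} (hK : IsCompact K)
    (hKf : K ⊆ Set.range f) : K.Finite := by
  obtain ⟨t, ht⟩ := hK.elim_finite_subcover (fun c => {f c}) h.isOpen_singleton_f
    (fun x hx => by
      obtain ⟨c, rfl⟩ := hKf hx
      exact Set.mem_iUnion.2 ⟨c, rfl⟩)
  exact (t.finite_toSet.biUnion fun c _ => Set.finite_singleton (f c)).subset ht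

theorem mul_eq_self_of_le {m n : ℤ} (hmn : m ≤ n) {x : T} (hx : f ⟨n, n⟩ * x = x) :
    f ⟨m, m⟩ * x = x := by
  rw [← hx, ← mul_assoc, f_mul]
  congr 3 <;> omega

/-! ### Classification of the points by their levels -/

/-- An element lies in a level, below all the levels, or above all of them. -/
theorem level_cases (x : T) : (∃ a : ℤ, f ⟨a, a⟩ * x = x ∧ f ⟨a + 1, a + 1⟩ * x ≠ x) ∨
    (∀ n : ℤ, f ⟨n, n⟩ * x = x) ∨ ∀ n : ℤ, f ⟨n, n⟩ * x ≠ x := by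
  by_contra! hx
  obtain ⟨h1, ⟨k, hk⟩, l, hl⟩ := hx
  have key : ∀ n : ℕ, f ⟨l + n, l + n⟩ * x = x := by
    intro n
    induction n with
    | zero => simpa using hl
    | succ n ih => simpa [add_assoc] using h1 _ ih
  apply hk
  exact mul_eq_self_of_le (n := l + (k - l).toNat) (by omega) (key _)

/-- Every `f ⟨n, n⟩` is absorbed by `x * i x`; this passes to the limit `1` of these idempotents. -/
theorem mul_inv_eq_one (h : IsDenseExtBicyclic f i) {x : T} (hx : ∀ n : ℤ, f ⟨n, n⟩ * x ≠ x) :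
    x * i x = 1 := by
  have hi := h.continuous_inv
  have key : ∀ n : ℤ, f ⟨n, n⟩ * (x * i x) = f ⟨n, n⟩ := by
    intro n
    have hP : IsClosed {x | f ⟨n, n⟩ * (x * i x) = f ⟨n, n⟩} :=
      isClosed_eq (by fun_prop) (by fun_prop)
    refine (h.closed_induction (p := fun x =>
      f ⟨n, n⟩ * x = x ∨ f ⟨n, n⟩ * (x * i x) = f ⟨n, n⟩)
      ((h.isClopen_lower n).isClosed.union hP) (fun a b => ?_) x).resolve_left (hx n)
    simp only [h.inv_f, f_mul, h.f_inj]
    omega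
  simpa using h.idempotent_induction (p := fun y => y * (x * i x) = y)
    (isClosed_eq (by fun_prop) (by fun_prop)) key (x := 1) (one_mul 1)

theorem f_ne_one (h : IsDenseExtBicyclic f i) (c : ExtBicyclic) : f c ≠ 1 := by
  obtain ⟨a, b⟩ := c
  intro hc
  have := mul_one (f ⟨a, b - 1⟩)
  rw [← hc, f_mul, h.f_inj] at this
  have h2 := one_mul (f ⟨a - 1, b⟩)
  rw [← hc, f_mul, h.f_inj] at h2
  omega

theorem f_mul_one_ne (h : IsDenseExtBicyclic f i) (n : ℤ) : f ⟨n, n⟩ * 1 ≠ (1 : T) := by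
  rw [mul_one]
  exact h.f_ne_one _

/-- No element lies above all the levels on the left and in a level on the right. -/
theorem not_top_level (h : IsDenseExtBicyclic f i) {x : T} (hx : ∀ n : ℤ, f ⟨n, n⟩ * x ≠ x)
    {b : ℤ} (h1 : x * f ⟨b, b⟩ = x) (h2 : x * f ⟨b + 1, b + 1⟩ ≠ x) : False := by
  have hi := h.continuous_inv
  have hL := h.mul_inv_eq_one hx
  have hR : i x * x = f ⟨b, b⟩ := by
    have hs : i (i x * x) = i x * x := by rw [h.inv_mul, h.inv_inv]
    have h3 : i x * x * f ⟨b, b⟩ = i x * x := by rw [mul_assoc, h1]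
    have h4 : i x * x * f ⟨b + 1, b + 1⟩ ≠ i x * x := by
      intro h5
      apply h2
      have := congrArg (x * ·) h5
      simpa [← mul_assoc, h.mul_inv_mul] using this
    apply h.eq_f_of_mem_cell _ _ h3 h4
    · rwa [h.mul_eq_self_iff, hs] at h3
    · rwa [Ne, h.mul_eq_self_iff, hs] at h4
  -- Conjugation by `x` sends `1` to the isolated point `f ⟨b, b⟩`, hence also some `f ⟨n, n⟩` near
  -- `1`. Conjugating back gives `f ⟨n, n⟩ = 1`.
  obtain ⟨n, hn⟩ := h.exists_idempotent_mem (U := (fun y => i x * y * x) ⁻¹' {f ⟨b, b⟩})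
    ((h.isOpen_singleton_f _).preimage (by fun_prop)) (x := 1) (one_mul 1) (by simpa using hR)
  have hn : i x * f ⟨n, n⟩ * x = f ⟨b, b⟩ := hn
  have h5 : x * (i x * f ⟨n, n⟩ * x) * i x = f ⟨n, n⟩ := by
    rw [show x * (i x * f ⟨n, n⟩ * x) * i x = x * i x * f ⟨n, n⟩ * (x * i x) by
      simp only [mul_assoc], hL, one_mul, mul_one]
  rw [hn, h1, hL] at h5
  exact h.f_ne_one _ h5.symm

/-- An element of a dense extension is a point of the extended bicyclic semigroup, is a unit, or
is below all the levels on one side. -/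
theorem classification (h : IsDenseExtBicyclic f i) (x : T) :
    x ∈ Set.range f ∨ (x * i x = 1 ∧ i x * x = 1) ∨ (∀ n : ℤ, f ⟨n, n⟩ * x = x) ∨
      ∀ n : ℤ, x * f ⟨n, n⟩ = x := by
  rcases level_cases (f := f) x with ⟨a, h1, h2⟩ | h1 | h1
  · rcases level_cases (f := f) (i x) with ⟨b, h3, h4⟩ | h3 | h3
    · rw [← h.mul_eq_self_iff] at h3
      rw [Ne, ← h.mul_eq_self_iff] at h4
      exact Or.inl ⟨_, (h.eq_f_of_mem_cell h1 h2 h3 h4).symm⟩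
    · simp only [← h.mul_eq_self_iff] at h3
      exact Or.inr (Or.inr (Or.inr h3))
    · refine (h.not_top_level h3 (b := a) ?_ ?_).elim
      · rwa [h.mul_eq_self_iff, h.inv_inv]
      · rwa [Ne, h.mul_eq_self_iff, h.inv_inv]
  · exact Or.inr (Or.inr (Or.inl h1))
  · rcases level_cases (f := f) (i x) with ⟨b, h3, h4⟩ | h3 | h3
    · rw [← h.mul_eq_self_iff] at h3
      rw [Ne, ← h.mul_eq_self_iff] at h4
      exact (h.not_top_level h1 h3 h4).elim
    · simp only [← h.mul_eq_self_iff] at h3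
      exact Or.inr (Or.inr (Or.inr h3))
    · refine Or.inr (Or.inl ⟨h.mul_inv_eq_one h1, ?_⟩)
      simpa [h.inv_inv] using h.mul_inv_eq_one h3

/-! ### The least ideal as a group -/

/-- `z` is an idempotent below all idempotents of the extended bicyclic semigroup. -/
structure IsBottom (f : ExtBicyclic →ₙ* T) (z : T) : Prop where
  mul_self : z * z = z
  f_mul_bot : ∀ n : ℤ, f ⟨n, n⟩ * z = z
  bot_mul_f : ∀ n : ℤ, z * f ⟨n, n⟩ = z

theorem exists_isBottom (h : IsDenseExtBicyclic f i) (hunits : ∀ u : Tˣ, u = 1) {x : T}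
    (hxf : x ∉ Set.range f) (hx1 : x ≠ 1) : ∃ z, IsBottom f z := by
  have key : ∀ x : T, (∀ n : ℤ, f ⟨n, n⟩ * x = x) → ∃ z, IsBottom f z := by
    intro x hx
    have h1 : ∀ n : ℤ, f ⟨n, n⟩ * (x * i x) = x * i x := fun n => by rw [← mul_assoc, hx]
    refine ⟨x * i x, h.idempotent_mul_self x, h1, fun n => ?_⟩
    rw [h.mul_eq_self_iff, h.inv_mul, h.inv_inv, h1]
  rcases h.classification x with h1 | ⟨h1, h2⟩ | h1 | h1
  · exact (hxf h1).elim
  · exact (hx1 (congrArg Units.val (hunits ⟨x, i x, h1, h2⟩))).elim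
  · exact key x h1
  · exact key (i x) fun n => (h.mul_eq_self_iff n x).1 (h1 n)

namespace IsBottom

variable {z : T}

theorem inv_bot (h : IsDenseExtBicyclic f i) (hz : IsBottom f z) : i z = z :=
  h.inv_of_isIdempotentElem hz.mul_self

theorem bot_mul_eq (h : IsDenseExtBicyclic f i) (hz : IsBottom f z) {x : T}
    (hx : ∀ n : ℤ, f ⟨n, n⟩ * x = x) : z * x = x :=
  h.idempotent_induction (p := fun y => y * x = x) (isClosed_eq (by fun_prop) (by fun_prop)) hx
    hz.mul_self

theorem mul_bot_eq (h : IsDenseExtBicyclic f i) (hz : IsBottom f z) {x : T}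
    (hx : ∀ n : ℤ, x * f ⟨n, n⟩ = x) : x * z = x :=
  h.idempotent_induction (p := fun y => x * y = x) (isClosed_eq (by fun_prop) (by fun_prop)) hx
    hz.mul_self

/-- Inserting a sufficiently low idempotent next to `z` moves both points to the same place on their
common diagonal. -/
theorem bot_mul_f_eq (hz : IsBottom f z) {a b c d : ℤ} (hab : b - a = d - c) :
    z * f ⟨a, b⟩ = z * f ⟨c, d⟩ := by
  rw [← hz.bot_mul_f (max a c), mul_assoc, mul_assoc, f_mul, f_mul]
  congr 3 <;> omega

theorem f_mul_bot_eq (hz : IsBottom f z) {a b c d : ℤ} (hab : b - a = d - c) :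
    f ⟨a, b⟩ * z = f ⟨c, d⟩ * z := by
  rw [← hz.f_mul_bot (max b d), ← mul_assoc, ← mul_assoc, f_mul, f_mul]
  congr 3 <;> omega

/-- On the copy, sliding along the diagonal shows that `z * f ⟨a, b⟩` is fixed on the right by every
`f ⟨n, n⟩`, hence by `z`. Symmetrically `z` fixes `f ⟨a, b⟩ * z` on the left, so both products equal
`z * f ⟨a, b⟩ * z`. -/
theorem comm (h : IsDenseExtBicyclic f i) (hz : IsBottom f z) (x : T) : z * x = x * z := by
  refine h.closed_induction (p := fun x => z * x = x * z)
    (isClosed_eq (by fun_prop) (by fun_prop)) (fun a b => ?_) x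
  have h1 : z * f ⟨a, b⟩ * z = z * f ⟨a, b⟩ := hz.mul_bot_eq h fun n => by
    rw [hz.bot_mul_f_eq (c := n + a - b) (d := n) (by omega), mul_assoc, f_mul]
    congr 3 <;> omega
  have h2 : z * (f ⟨a, b⟩ * z) = f ⟨a, b⟩ * z := hz.bot_mul_eq h fun n => by
    rw [hz.f_mul_bot_eq (c := n) (d := n + b - a) (by omega), ← mul_assoc, f_mul]
    congr 3 <;> omega
  rw [← h1, mul_assoc, h2]

/-- As `z` is central, this makes `z * i x` the inverse of `z * x` in a group with identity `z`. -/
theorem bot_mul_inv (h : IsDenseExtBicyclic f i) (hz : IsBottom f z) (x : T) :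
    z * (x * i x) = z := by
  have hi := h.continuous_inv
  refine h.closed_induction (p := fun x => z * (x * i x) = z)
    (isClosed_eq (by fun_prop) (by fun_prop)) (fun a b => ?_) x
  rw [h.inv_f, f_mul, ← hz.bot_mul_f a]
  simp [hz.bot_mul_f]

/-- The value at `k` of the homomorphism from the integers onto the least ideal. -/
def elem (f : ExtBicyclic →ₙ* T) (z : T) (k : ℤ) : T := z * f ⟨0, k⟩

theorem bot_mul_f_eq_elem (hz : IsBottom f z) (a b : ℤ) : z * f ⟨a, b⟩ = elem f z (b - a) :=
  hz.bot_mul_f_eq (by omega)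

theorem elem_zero (hz : IsBottom f z) : elem f z 0 = z := hz.bot_mul_f 0

theorem bot_mul_elem (hz : IsBottom f z) (k : ℤ) : z * elem f z k = elem f z k := by
  rw [elem, ← mul_assoc, hz.mul_self]

theorem elem_mul_f (hz : IsBottom f z) (k a b : ℤ) :
    elem f z k * f ⟨a, b⟩ = elem f z (k + b - a) := by
  rw [elem, mul_assoc, f_mul, hz.bot_mul_f_eq_elem]
  congr 1
  omega

theorem f_mul_elem (h : IsDenseExtBicyclic f i) (hz : IsBottom f z) (k a b : ℤ) :
    f ⟨a, b⟩ * elem f z k = elem f z (k + b - a) := by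
  rw [elem, ← mul_assoc, ← hz.comm h, mul_assoc, f_mul, hz.bot_mul_f_eq_elem]
  congr 1
  omega

theorem elem_mul_elem (h : IsDenseExtBicyclic f i) (hz : IsBottom f z) (k l : ℤ) :
    elem f z k * elem f z l = elem f z (k + l) := by
  rw [elem, mul_assoc, hz.f_mul_elem h, hz.bot_mul_elem]
  congr 1
  omega

theorem inv_elem (h : IsDenseExtBicyclic f i) (hz : IsBottom f z) (k : ℤ) :
    i (elem f z k) = elem f z (-k) := by
  rw [elem, h.inv_mul, h.inv_f, hz.inv_bot h, ← hz.comm h, hz.bot_mul_f_eq_elem]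
  congr 1
  omega

theorem f_ne_bot_mul (h : IsDenseExtBicyclic f i) (hz : IsBottom f z) (a b : ℤ) (x : T) :
    f ⟨a, b⟩ ≠ z * x := by
  intro hx
  have : f ⟨a + 1, a + 1⟩ * f ⟨a, b⟩ = f ⟨a, b⟩ := by rw [hx, ← mul_assoc, hz.f_mul_bot]
  rw [f_mul, h.f_inj] at this
  omega

theorem bot_mul_ne_one (h : IsDenseExtBicyclic f i) (hz : IsBottom f z) (x : T) :
    z * x ≠ 1 := by
  intro hx
  have : f ⟨0, 0⟩ * (z * x) = z * x := by rw [← mul_assoc, hz.f_mul_bot]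
  rw [hx] at this
  exact h.f_mul_one_ne 0 this

theorem cases (h : IsDenseExtBicyclic f i) (hunits : ∀ u : Tˣ, u = 1) (hz : IsBottom f z)
    (x : T) : x ∈ Set.range f ∨ x = 1 ∨ z * x = x := by
  rcases h.classification x with h1 | ⟨h1, h2⟩ | h1 | h1
  · exact Or.inl h1
  · exact Or.inr (Or.inl (congrArg Units.val (hunits ⟨x, i x, h1, h2⟩)))
  · exact Or.inr (Or.inr (hz.bot_mul_eq h h1))
  · exact Or.inr (Or.inr ((hz.comm h x).trans (hz.mul_bot_eq h h1)))

/-- An open set which meets the least ideal meets the image of the integers. -/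
theorem exists_elem_mem (h : IsDenseExtBicyclic f i) (hz : IsBottom f z) {U : Set T}
    (hU : IsOpen U) {x : T} (hx : z * x = x) (hxU : x ∈ U) : ∃ k, elem f z k ∈ U := by
  obtain ⟨a, b, hab⟩ := h.exists_mem_open (U := (fun y => z * y) ⁻¹' U) (x := x)
    (hU.preimage (by fun_prop)) (by simpa [hx] using hxU)
  refine ⟨b - a, ?_⟩
  rw [← hz.bot_mul_f_eq_elem]
  exact hab

/-- A neighbourhood of the bottom contains idempotents below any given one. -/
theorem exists_f_mem (h : IsDenseExtBicyclic f i) (hz : IsBottom f z) {U : Set T}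
    (hU : IsOpen U) (hzU : z ∈ U) (N : ℤ) : ∃ n, N ≤ n ∧ f ⟨n, n⟩ ∈ U := by
  obtain ⟨n, hn, hn'⟩ := h.exists_idempotent_mem (hU.inter (h.isClopen_lower N).isOpen)
    hz.mul_self ⟨hzU, hz.f_mul_bot N⟩
  refine ⟨n, ?_, hn⟩
  simp only [Set.mem_ofPred_eq, f_mul, h.f_inj] at hn'
  omega

/-! ### Discreteness of the least ideal -/

/-- A compact set has finitely many points in each row. -/
theorem finite_row (h : IsDenseExtBicyclic f i) (hz : IsBottom f z) {K : Set T} (hK : IsCompact K) (n : ℤ) :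
    {b : ℤ | f ⟨n, b⟩ ∈ K}.Finite := by
  have hK' : IsCompact (K ∩ ({x | f ⟨n, n⟩ * x = x} ∩ {x | f ⟨n + 1, n + 1⟩ * x = x}ᶜ)) :=
    hK.inter_right ((h.isClopen_lower _).isClosed.inter (h.isClopen_lower _).compl.isClosed)
  have hrow : K ∩ ({x | f ⟨n, n⟩ * x = x} ∩ {x | f ⟨n + 1, n + 1⟩ * x = x}ᶜ) ⊆ Set.range f := by
    rintro x ⟨-, h1, h2⟩
    simp only [Set.mem_ofPred_eq, Set.mem_compl_iff] at h1 h2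
    rcases h.classification x with h3 | ⟨h3, -⟩ | h3 | h3
    · exact h3
    · have := congrArg (· * i x) h1
      simp only [mul_assoc, h3] at this
      exact (h.f_mul_one_ne n this).elim
    · exact (h2 (h3 _)).elim
    · refine (h2 ?_).elim
      rw [← hz.mul_bot_eq h h3, ← hz.comm h, ← mul_assoc, hz.f_mul_bot]
  have hfin := h.finite_of_isCompact hK' hrow
  refine (hfin.preimage (f := fun b => f ⟨n, b⟩) ?_).subset ?_
  · intro b _ c _ hbc
    exact (h.f_inj.1 hbc).2
  · intro b hb
    refine ⟨hb, ?_, ?_⟩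
    · simp only [Set.mem_ofPred_eq, f_mul, h.f_inj]
      omega
    · simp only [Set.mem_ofPred_eq, Set.mem_compl_iff, f_mul, h.f_inj]
      omega

/-- The positive multiples of some element of the least ideal avoid the interior of a given
compact set. -/
theorem exists_forall_mul_elem_notMem (h : IsDenseExtBicyclic f i) (hunits : ∀ u : Tˣ, u = 1)
    (hz : IsBottom f z) {K : Set T} (hK : IsCompact K) (hzK : K ∈ 𝓝 z)
    (hK0 : ∀ x ∈ K, x * f ⟨0, 0⟩ = x) :
    ∃ x, z * x = x ∧ ∀ k : ℤ, 0 < k → x * elem f z k ∉ interior K := by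
  by_contra! hcon
  have hKH : IsCompact (K ∩ {x | z * x = x}) :=
    hK.inter_right (isClosed_eq (by fun_prop) (by fun_prop))
  let O : {k : ℤ // 0 < k} → Set T := fun k => (fun x => x * f ⟨0, k⟩) ⁻¹' interior K
  have hO : ∀ k, IsOpen (O k) := fun k => isOpen_interior.preimage (by fun_prop)
  obtain ⟨t, ht⟩ := hKH.elim_finite_subcover O hO (fun x hx => by
    obtain ⟨k, hk, hkx⟩ := hcon x hx.2
    refine Set.mem_iUnion.2 ⟨⟨k, hk⟩, ?_⟩
    have hx2 : z * x = x := hx.2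
    have : x * f ⟨0, k⟩ = x * elem f z k := by
      rw [elem, ← mul_assoc, ← hz.comm h, hx2]
    change x * f ⟨0, k⟩ ∈ interior K
    rwa [this])
  have hrest : IsCompact (K \ ⋃ k ∈ t, O k) :=
    hK.diff (isOpen_biUnion fun k _ => hO k)
  -- Outside the finite cover, `K` has only points of the copy: `hK0` excludes `1`, and the least
  -- ideal is covered.
  have hfin := h.finite_of_isCompact hrest (by
    rintro x ⟨hxK, hx⟩
    rcases hz.cases h hunits x with h1 | rfl | h1
    · exact h1
    · have := hK0 _ hxK
      rw [one_mul] at this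
      exact (h.f_ne_one _ this).elim
    · exact (hx (ht ⟨hxK, h1⟩)).elim)
  have hfin' := (hfin.preimage h.injective.injOn).image ExtBicyclic.fst
  obtain ⟨N, hN⟩ := hfin'.bddAbove
  obtain ⟨n, hn, hnK⟩ := hz.exists_f_mem h isOpen_interior (mem_interior_iff_mem_nhds.2 hzK) (N + 1)
  -- Row `n` lies beyond the finitely many uncovered points, so its last point in `K` belongs to
  -- some `O k`. As `0 ≤ b`, multiplication by `f ⟨0, k⟩` moves it to `f ⟨n, b + k⟩`, still in `K`.
  obtain ⟨b, hb, hmax⟩ := (hz.finite_row h hK n).exists_maximal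
    ⟨n, interior_subset (s := K) hnK⟩
  have hb0 : 0 ≤ b := by
    have := hK0 _ hb
    rw [f_mul, h.f_inj] at this
    omega
  have hmem : f ⟨n, b⟩ ∈ ⋃ k ∈ t, O k := by
    by_contra hnot
    have : n ≤ N := hN ⟨⟨n, b⟩, ⟨hb, hnot⟩, rfl⟩
    omega
  obtain ⟨k, -, hk⟩ := Set.mem_iUnion₂.1 hmem
  have hk' : f ⟨n, b⟩ * f ⟨0, k⟩ ∈ K := interior_subset hk
  have hk0 := k.2
  rw [f_mul] at hk'
  have hk'' : f ⟨n, b + k⟩ ∈ K := by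
    convert hk' using 3 <;> omega
  have := hmax hk'' (by omega)
  omega

/-- Some neighbourhood of the bottom contains only finitely many powers of the generator. -/
theorem exists_bounded_nhd [LocallyCompactSpace T] (h : IsDenseExtBicyclic f i)
    (hunits : ∀ u : Tˣ, u = 1) (hz : IsBottom f z) :
    ∃ W : Set T, IsOpen W ∧ z ∈ W ∧ ∃ J : ℤ, ∀ k, elem f z k ∈ W → |k| ≤ J := by
  obtain ⟨K, hKz, hK0, hK⟩ := local_compact_nhds
    ((h.isClopen_lower' 0).isOpen.mem_nhds (hz.bot_mul_f 0))
  obtain ⟨x, hx, hxk⟩ := hz.exists_forall_mul_elem_notMem h hunits hK hKz hK0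
  have hV : IsOpen ((fun y => x * y) ⁻¹' interior K) := isOpen_interior.preimage (by fun_prop)
  -- The group inverse of `x` is approximated by `elem f z j`, so that `x * elem f z j` lies in the
  -- interior of `K`.
  obtain ⟨j, hj⟩ := hz.exists_elem_mem h hV (x := z * i x)
    (by rw [← mul_assoc, hz.mul_self]) (by
      change x * (z * i x) ∈ interior K
      rw [← mul_assoc, ← hz.comm h, mul_assoc, hz.bot_mul_inv h]
      exact mem_interior_iff_mem_nhds.2 hKz)
  let W₀ : Set T := (fun y => x * (y * elem f z j)) ⁻¹' interior K
  have hW₀ : IsOpen W₀ := isOpen_interior.preimage (by fun_prop)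
  have hzW₀ : z ∈ W₀ := by
    change x * (z * elem f z j) ∈ interior K
    rwa [hz.bot_mul_elem]
  have hk : ∀ k, elem f z k ∈ W₀ → k ≤ -j := by
    intro k hk
    have hk' : x * (elem f z k * elem f z j) ∈ interior K := hk
    rw [hz.elem_mul_elem h] at hk'
    by_contra hlt
    exact hxk (k + j) (by omega) hk'
  -- Intersecting with the inverse turns the upper bound on `k` into a bound on `|k|`.
  refine ⟨W₀ ∩ i ⁻¹' W₀, hW₀.inter (hW₀.preimage h.continuous_inv), ⟨hzW₀, ?_⟩, -j, ?_⟩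
  · change i z ∈ W₀
    rwa [hz.inv_bot h]
  · rintro k ⟨h1, h2⟩
    have h2 : i (elem f z k) ∈ W₀ := h2
    rw [hz.inv_elem h] at h2
    rw [abs_le]
    have := hk _ h1
    have := hk _ h2
    omega

theorem elem_mul_nat (h : IsDenseExtBicyclic f i) (hz : IsBottom f z) {k : ℤ}
    (hk : elem f z k = z) (n : ℕ) : elem f z (k * n) = z := by
  induction n with
  | zero => simpa using hz.elem_zero
  | succ n ih =>
    rw [Nat.cast_succ, mul_add, mul_one, ← hz.elem_mul_elem h, ih, hk, hz.mul_self]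

/-- A nontrivial period would put arbitrarily large multiples into the bounded neighbourhood of `z`.
-/
theorem elem_injective [LocallyCompactSpace T] (h : IsDenseExtBicyclic f i)
    (hunits : ∀ u : Tˣ, u = 1) (hz : IsBottom f z) : Function.Injective (elem f z) := by
  obtain ⟨W, -, hzW, J, hJ⟩ := hz.exists_bounded_nhd h hunits
  intro k l hkl
  by_contra hne
  have h1 : elem f z (k - l) = z := by
    rw [sub_eq_add_neg, ← hz.elem_mul_elem h, hkl, hz.elem_mul_elem h, add_neg_cancel,
      hz.elem_zero]
  have h2 := hJ ((k - l) * ((J.toNat + 1 : ℕ) : ℤ)) (by rwa [hz.elem_mul_nat h h1])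
  rw [abs_mul, Nat.abs_cast] at h2
  have h3 : 1 ≤ |k - l| := Int.one_le_abs (by omega)
  have h4 : ((J.toNat + 1 : ℕ) : ℤ) ≤ |k - l| * ((J.toNat + 1 : ℕ) : ℤ) :=
    le_mul_of_one_le_left (by positivity) h3
  omega

/-- The bottom is isolated in the least ideal. -/
theorem exists_isolating_nhd [LocallyCompactSpace T] (h : IsDenseExtBicyclic f i)
    (hunits : ∀ u : Tˣ, u = 1) (hz : IsBottom f z) :
    ∃ W : Set T, IsOpen W ∧ z ∈ W ∧ ∀ x ∈ W, z * x = x → x = z := by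
  obtain ⟨W, hW, hzW, J, hJ⟩ := hz.exists_bounded_nhd h hunits
  have hfin : (elem f z '' (Set.Icc (-J) J \ {0})).Finite :=
    ((Set.finite_Icc _ _).subset Set.sdiff_subset).image _
  refine ⟨W \ elem f z '' (Set.Icc (-J) J \ {0}), hW.sdiff hfin.isClosed, ⟨hzW, ?_⟩, ?_⟩
  · rintro ⟨k, ⟨-, hk⟩, hkz⟩
    exact hk (hz.elem_injective h hunits (hkz.trans hz.elem_zero.symm))
  · rintro x ⟨hxW, hx⟩ hzx
    by_contra hne
    obtain ⟨k, ⟨hkW, hk⟩, hkz⟩ := hz.exists_elem_mem h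
      ((hW.sdiff hfin.isClosed).inter isOpen_compl_singleton) (x := x) hzx ⟨⟨hxW, hx⟩, hne⟩
    refine hk ⟨k, ⟨abs_le.1 (hJ k hkW), ?_⟩, rfl⟩
    rintro rfl
    exact hkz hz.elem_zero

/-- A power close enough to `x` satisfies `i x * elem f z k = z`, because `z` is isolated in the
least ideal. -/
theorem eq_elem_of_bot_mul [LocallyCompactSpace T] (h : IsDenseExtBicyclic f i)
    (hunits : ∀ u : Tˣ, u = 1) (hz : IsBottom f z) {x : T} (hx : z * x = x) :
    ∃ k, x = elem f z k := by
  obtain ⟨W, hW, hzW, hWz⟩ := hz.exists_isolating_nhd h hunits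
  have hR : i x * x = z := by
    have := hz.bot_mul_inv h (i x)
    rw [h.inv_inv, ← mul_assoc, hz.comm h, mul_assoc, hx] at this
    exact this
  have hL : x * i x = z := by
    have := hz.bot_mul_inv h x
    rwa [← mul_assoc, hx] at this
  obtain ⟨k, hk⟩ := hz.exists_elem_mem h (U := (fun y => i x * y) ⁻¹' W)
    (hW.preimage (by fun_prop)) hx (by simpa [hR] using hzW)
  have h1 : i x * elem f z k = z := by
    refine hWz _ hk ?_
    rw [← mul_assoc, hz.comm h, mul_assoc, hz.bot_mul_elem]
  refine ⟨k, ?_⟩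
  have h2 := congrArg (x * ·) h1
  simp only [← mul_assoc, hL] at h2
  rw [hz.bot_mul_elem, ← hz.comm h, hx] at h2
  exact h2.symm

theorem isOpen_fiber [LocallyCompactSpace T] (h : IsDenseExtBicyclic f i)
    (hunits : ∀ u : Tˣ, u = 1) (hz : IsBottom f z) (k : ℤ) :
    IsOpen {x | z * x = elem f z k} := by
  obtain ⟨W, hW, hzW, hWz⟩ := hz.exists_isolating_nhd h hunits
  have hO : IsOpen ((fun x => elem f z (-k) * x) ⁻¹' W) := hW.preimage (by fun_prop)
  convert hO
  ext x
  simp only [Set.mem_ofPred_eq, Set.mem_preimage]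
  have h0 : z * (elem f z (-k) * x) = elem f z (-k) * x := by
    rw [← mul_assoc, hz.bot_mul_elem]
  have h0' : elem f z (-k) * x = elem f z (-k) * (z * x) := by
    rw [← mul_assoc, ← hz.comm h, hz.bot_mul_elem]
  constructor
  · intro hx
    rw [h0', hx, hz.elem_mul_elem h, neg_add_cancel, hz.elem_zero]
    exact hzW
  · intro hx
    have h1 := congrArg (elem f z k * ·) (hWz _ hx h0)
    simp only [← mul_assoc, hz.elem_mul_elem h, add_neg_cancel, hz.elem_zero] at h1
    rw [h1, ← hz.comm h, hz.bot_mul_elem]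

/-! ### Neighbourhoods of the integers -/

/-- The idempotents of the extended bicyclic semigroup converge to the bottom. -/
theorem eventually_f_mem [LocallyCompactSpace T] (h : IsDenseExtBicyclic f i)
    (hunits : ∀ u : Tˣ, u = 1) (hz : IsBottom f z) {U : Set T} (hU : IsOpen U) (hzU : z ∈ U) :
    ∃ N : ℤ, ∀ n, N ≤ n → f ⟨n, n⟩ ∈ U := by
  obtain ⟨W, hW, hzW, hWz⟩ := hz.exists_isolating_nhd h hunits
  obtain ⟨K, hKz, hKW, hK⟩ := local_compact_nhds
    ((hW.inter (h.isClopen_lower 0).isOpen).mem_nhds ⟨hzW, hz.f_mul_bot 0⟩)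
  -- In `K` the only point outside the copy is `z`, so `K \ V` is finite.
  have key : ∀ V : Set T, IsOpen V → z ∈ V →
      ∃ N : ℤ, ∀ n, N ≤ n → f ⟨n, n⟩ ∈ K → f ⟨n, n⟩ ∈ V := by
    intro V hV hzV
    have hfin := h.finite_of_isCompact (hK.diff hV) (by
      rintro x ⟨hxK, hxV⟩
      rcases hz.cases h hunits x with h1 | rfl | h1
      · exact h1
      · exact (h.f_mul_one_ne 0 (hKW hxK).2).elim
      · rw [hWz x (hKW hxK).1 h1] at hxV
        exact (hxV hzV).elim)
    obtain ⟨N, hN⟩ := ((hfin.preimage h.injective.injOn).image ExtBicyclic.fst).bddAbove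
    refine ⟨N + 1, fun n hn hnK => ?_⟩
    by_contra hnV
    have : n ≤ N := hN ⟨⟨n, n⟩, ⟨hnK, hnV⟩, rfl⟩
    omega
  -- This map fixes `z` and sends `f ⟨n, n⟩` to `f ⟨n + 1, n + 1⟩` for `0 ≤ n`. Beyond `N`,
  -- membership in `K` therefore propagates from each idempotent to the next.
  obtain ⟨N, hN⟩ := key ((fun x => f ⟨1, 0⟩ * x * f ⟨0, 1⟩) ⁻¹' interior K)
    (isOpen_interior.preimage (by fun_prop)) (by
      change f ⟨1, 0⟩ * z * f ⟨0, 1⟩ ∈ interior K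
      rw [← hz.comm h, mul_assoc, f_mul, show z * f ⟨1 + max 0 (0 - 0), 1 + max 0 (0 - 0)⟩ = z from
        hz.bot_mul_f _]
      exact mem_interior_iff_mem_nhds.2 hKz)
  obtain ⟨M, hM⟩ := key U hU hzU
  obtain ⟨n₀, hn₀, hn₀K⟩ := hz.exists_f_mem h isOpen_interior (mem_interior_iff_mem_nhds.2 hKz)
    (max N 0)
  have hall : ∀ k : ℕ, f ⟨n₀ + k, n₀ + k⟩ ∈ K := by
    intro k
    induction k with
    | zero => simpa using interior_subset hn₀K
    | succ k ih =>
      have h1 : f ⟨1, 0⟩ * f ⟨n₀ + k, n₀ + k⟩ * f ⟨0, 1⟩ ∈ K :=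
        interior_subset (hN (n₀ + k) (by omega) ih)
      rw [f_mul, f_mul] at h1
      convert h1 using 3 <;> push_cast <;> omega
  refine ⟨max M n₀, fun n hn => hM n (by omega) ?_⟩
  have := hall (n - n₀).toNat
  rwa [show n₀ + ((n - n₀).toNat : ℤ) = n by omega] at this

theorem mem_nhds_elem_iff [LocallyCompactSpace T] (h : IsDenseExtBicyclic f i)
    (hunits : ∀ u : Tˣ, u = 1) (hz : IsBottom f z) (k : ℤ) (V : Set T) :
    V ∈ 𝓝 (elem f z k) ↔ elem f z k ∈ V ∧ ∃ N : ℤ, ∀ a, N ≤ a → f ⟨a, a + k⟩ ∈ V := by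
  constructor
  · refine fun hV => ⟨mem_of_mem_nhds hV, ?_⟩
    obtain ⟨N, hN⟩ := hz.eventually_f_mem h hunits
      (U := (fun x => x * f ⟨0, k⟩) ⁻¹' interior V) (isOpen_interior.preimage (by fun_prop))
      (mem_interior_iff_mem_nhds.2 hV)
    refine ⟨max N 0, fun a ha => ?_⟩
    have : f ⟨a, a⟩ * f ⟨0, k⟩ ∈ V := interior_subset (hN a (by omega))
    rw [f_mul] at this
    convert this using 3 <;> omega
  · rintro ⟨hkV, N, hN⟩
    -- The fibre of `x ↦ z * x` over `elem f z k`, cut at level `N`, contains only `elem f z k` and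
    -- the points `f ⟨a, a + k⟩` with `N ≤ a`.
    refine mem_of_superset (((hz.isOpen_fiber h hunits k).inter
      (h.isClopen_lower N).isOpen).mem_nhds ⟨hz.bot_mul_elem k, ?_⟩) ?_
    · change f ⟨N, N⟩ * elem f z k = elem f z k
      rw [hz.f_mul_elem h]
      congr 1
      omega
    · rintro x ⟨h1, h2⟩
      simp only [Set.mem_ofPred_eq] at h1 h2
      rcases hz.cases h hunits x with ⟨⟨a, b⟩, rfl⟩ | rfl | h3
      · rw [hz.bot_mul_f_eq_elem] at h1
        have h4 := hz.elem_injective h hunits h1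
        rw [f_mul, h.f_inj] at h2
        have := hN a (by omega)
        rwa [show a + k = b by omega] at this
      · exact (h.f_mul_one_ne N h2).elim
      · rwa [← h3, h1]

end IsBottom

/-! ### Neighbourhoods of the unit -/

/-- Elements near the unit are idempotents of the extended bicyclic semigroup or the unit. -/
theorem eq_f_or_eq_one (h : IsDenseExtBicyclic f i) (hunits : ∀ u : Tˣ, u = 1) {x : T}
    (hx : f ⟨-1, -1⟩ * x = f ⟨-1, -1⟩) : (∃ n : ℤ, n ≤ -1 ∧ x = f ⟨n, n⟩) ∨ x = 1 := by
  by_cases hxf : x ∈ Set.range f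
  · obtain ⟨⟨a, b⟩, rfl⟩ := hxf
    rw [f_mul, h.f_inj] at hx
    refine Or.inl ⟨a, by omega, ?_⟩
    congr 2
    omega
  · by_cases hx1 : x = 1
    · exact Or.inr hx1
    · obtain ⟨z, hz⟩ := h.exists_isBottom hunits hxf hx1
      rcases hz.cases h hunits x with h1 | h1 | h1
      · exact (hxf h1).elim
      · exact (hx1 h1).elim
      · rw [← h1, ← mul_assoc, hz.f_mul_bot] at hx
        exact (hz.f_ne_bot_mul h _ _ _ hx.symm).elim

theorem exists_nhds_one [LocallyCompactSpace T] (h : IsDenseExtBicyclic f i)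
    (hunits : ∀ u : Tˣ, u = 1) :
    ∃ m : ℕ → ℤ, StrictAnti m ∧ (∀ j, m j < 0) ∧ ∀ V : Set T,
      V ∈ 𝓝 1 ↔ 1 ∈ V ∧ ∃ n : ℕ, ∀ j, n ≤ j → f ⟨m j, m j⟩ ∈ V := by
  have hW : IsOpen {x : T | f ⟨-1, -1⟩ * x = f ⟨-1, -1⟩} :=
    (h.isOpen_singleton_f ⟨-1, -1⟩).preimage (f := fun x => f ⟨-1, -1⟩ * x) (by fun_prop)
  obtain ⟨K, hK1, hKW, hK⟩ := local_compact_nhds (hW.mem_nhds (mul_one (f ⟨-1, -1⟩)))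
  have hKcases : ∀ x ∈ K, (∃ n : ℤ, n ≤ -1 ∧ x = f ⟨n, n⟩) ∨ x = 1 :=
    fun x hx => h.eq_f_or_eq_one hunits (hKW hx)
  let p : ℕ → Prop := fun k => f ⟨-(k : ℤ), -(k : ℤ)⟩ ∈ K
  -- Otherwise, removing finitely many points from the interior of `K` leaves a neighbourhood of `1`
  -- that misses the dense copy.
  have hp : (Set.ofPred p).Infinite := by
    intro hfin
    have hfin' := hfin.image fun k : ℕ => f ⟨-(k : ℤ), -(k : ℤ)⟩
    obtain ⟨a, b, hab, hab'⟩ := h.exists_mem_open (isOpen_interior.sdiff hfin'.isClosed)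
      (x := (1 : T)) ⟨mem_interior_iff_mem_nhds.2 hK1, by
        rintro ⟨k, -, hk⟩
        exact h.f_ne_one _ hk⟩
    rcases hKcases _ (interior_subset hab) with ⟨n, hn, hn'⟩ | h1
    · have hk : f ⟨a, b⟩ = f ⟨-((-n).toNat : ℤ), -((-n).toNat : ℤ)⟩ := by
        rw [hn']
        congr 2 <;> omega
      exact hab' ⟨(-n).toNat, show _ ∈ K from hk ▸ interior_subset hab, hk.symm⟩
    · exact h.f_ne_one _ h1
  have hmono := Nat.nth_strictMono hp
  have hneg : ∀ k, p k → 1 ≤ k := by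
    intro k hk
    have hk' : f ⟨-1, -1⟩ * f ⟨-(k : ℤ), -(k : ℤ)⟩ = f ⟨-1, -1⟩ := hKW hk
    rw [f_mul, h.f_inj] at hk'
    omega
  refine ⟨fun j => -(Nat.nth p j : ℤ), fun a b hab => ?_, fun j => ?_, fun V => ⟨fun hV => ?_, ?_⟩⟩
  · have := hmono hab
    simp only
    omega
  · have := hneg _ (Nat.nth_mem_of_infinite hp j)
    simp only
    omega
  · refine ⟨mem_of_mem_nhds hV, ?_⟩
    -- The set `K` less the interior of `V` is compact and inside the copy, so all but finitely many
    -- of the enumerated idempotents lie in `V`.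
    have hfin := h.finite_of_isCompact (hK.diff (isOpen_interior (s := V))) (by
      rintro x ⟨hxK, hxV⟩
      rcases hKcases x hxK with ⟨n, -, rfl⟩ | rfl
      · exact ⟨_, rfl⟩
      · exact (hxV (mem_interior_iff_mem_nhds.2 hV)).elim)
    obtain ⟨N, hN⟩ := ((hfin.preimage h.injective.injOn).image ExtBicyclic.fst).bddBelow
    -- Since `j ≤ Nat.nth p j`, these `j` give indices strictly below `N`.
    refine ⟨(-N).toNat + 1, fun j hj => ?_⟩
    by_contra hjV
    have h1 : N ≤ -(Nat.nth p j : ℤ) := hN ⟨⟨_, _⟩,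
      ⟨Nat.nth_mem_of_infinite hp j, fun h2 => hjV (interior_subset h2)⟩, rfl⟩
    have h2 := hmono.le_apply (x := j)
    omega
  · rintro ⟨h1V, n, hn⟩
    have hfin : ((fun j => f ⟨-(Nat.nth p j : ℤ), -(Nat.nth p j : ℤ)⟩) '' Set.Iio n).Finite :=
      (Set.finite_Iio n).image _
    refine mem_of_superset ((isOpen_interior.sdiff hfin.isClosed).mem_nhds
      ⟨mem_interior_iff_mem_nhds.2 hK1, ?_⟩) ?_
    · rintro ⟨j, -, hj⟩
      exact h.f_ne_one _ hj
    · rintro x ⟨hxK, hx⟩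
      have hxK := interior_subset hxK
      rcases hKcases x hxK with ⟨l, hl, rfl⟩ | rfl
      · have hl' : l = -((-l).toNat : ℤ) := by omega
        have hpl : p (-l).toNat := by
          change f ⟨_, _⟩ ∈ K
          rwa [← hl']
        obtain ⟨j, hj⟩ : (-l).toNat ∈ Set.range (Nat.nth p) := by
          rw [Nat.range_nth_of_infinite hp]
          exact hpl
        have hlj : l = -(Nat.nth p j : ℤ) := by rw [hj, ← hl']
        have hnj : n ≤ j := by
          by_contra hlt
          exact hx ⟨j, not_le.1 hlt, by simp only [← hlj]⟩
        have := hn j hnj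
        simp only [← hlj] at this
        exact this
      · exact h1V

/-! ### Identification with the two models -/

theorem isOpen_iff (h : IsDenseExtBicyclic f i) (V : Set T) :
    IsOpen V ↔ ∀ x ∈ V, x ∉ Set.range f → V ∈ 𝓝 x := by
  rw [isOpen_iff_mem_nhds]
  refine ⟨fun hV x hx _ => hV x hx, fun hV x hx => ?_⟩
  by_cases hxf : x ∈ Set.range f
  · obtain ⟨c, rfl⟩ := hxf
    exact mem_of_superset ((h.isOpen_singleton_f c).mem_nhds rfl) (by simpa using hx)
  · exact hV x hx hxf

/-- A monoid whose only new point is the unit is an extension `S1 m`. -/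
theorem nonempty_equiv_S1 (h : IsDenseExtBicyclic f i) {m : ℕ → ℤ}
    (hm : ∀ V : Set T, V ∈ 𝓝 1 ↔ 1 ∈ V ∧ ∃ n : ℕ, ∀ j, n ≤ j → f ⟨m j, m j⟩ ∈ V)
    (hcases : ∀ x : T, x ∈ Set.range f ∨ x = 1) : Nonempty (T ≃ₜ* S1 m) := by
  let φ : S1 m →* T := WithOne.lift f
  have hφ1 : φ 1 = 1 := map_one φ
  have hφf : ∀ c, φ (S1.of c) = f c := fun c => WithOne.lift_coe f c
  have hall : ∀ x : S1 m, x = 1 ∨ ∃ c, x = S1.of c := fun x =>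
    WithOne.cases_on (P := fun x => x = (1 : S1 m) ∨ ∃ c, x = S1.of c) x (Or.inl rfl)
      fun c => Or.inr ⟨c, rfl⟩
  have hbij : Function.Bijective φ := by
    constructor
    · intro x y hxy
      rcases hall x with rfl | ⟨c, rfl⟩ <;> rcases hall y with rfl | ⟨d, rfl⟩
      · rfl
      · rw [hφ1, hφf] at hxy
        exact (h.f_ne_one d hxy.symm).elim
      · rw [hφ1, hφf] at hxy
        exact (h.f_ne_one c hxy).elim
      · rw [hφf, hφf] at hxy
        rw [h.injective hxy]
    · intro x
      rcases hcases x with ⟨c, rfl⟩ | rfl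
      · exact ⟨_, hφf c⟩
      · exact ⟨1, hφ1⟩
  have hopen : ∀ V : Set T, IsOpen (φ ⁻¹' V) ↔ IsOpen V := by
    intro V
    rw [h.isOpen_iff]
    constructor
    · intro hV x hxV hxf
      obtain rfl := (hcases x).resolve_left hxf
      obtain ⟨n, hn⟩ := hV (show φ 1 ∈ V by rwa [hφ1])
      refine (hm V).2 ⟨hxV, n, fun j hj => ?_⟩
      rw [← hφf]
      exact hn (Or.inr ⟨j, hj, rfl⟩)
    · intro hV h1
      have h1' : φ 1 ∈ V := h1
      rw [hφ1] at h1'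
      obtain ⟨-, n, hn⟩ := (hm V).1 (hV 1 h1' fun ⟨c, hc⟩ => h.f_ne_one c hc)
      refine ⟨n, ?_⟩
      rintro x (rfl | ⟨j, hj, rfl⟩)
      · exact h1
      · change φ _ ∈ V
        rw [hφf]
        exact hn j hj
  let e : S1 m ≃* T := MulEquiv.ofBijective φ hbij
  refine ⟨ContinuousMulEquiv.symm ⟨e, ?_, ?_⟩⟩
  · exact continuous_def.2 fun V hV => (hopen V).2 hV
  · refine continuous_def.2 fun V hV => ?_
    refine (hopen _).1 ?_
    convert hV
    ext x
    exact iff_of_eq (congrArg (· ∈ V) (e.symm_apply_apply x))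

/-- A monoid whose only new points are the unit and the integers is an extension `S4 m`. -/
theorem nonempty_equiv_S4 [LocallyCompactSpace T] (h : IsDenseExtBicyclic f i)
    (hunits : ∀ u : Tˣ, u = 1) {z : T} (hz : IsBottom f z) {m : ℕ → ℤ}
    (hm : ∀ V : Set T, V ∈ 𝓝 1 ↔ 1 ∈ V ∧ ∃ n : ℕ, ∀ j, n ≤ j → f ⟨m j, m j⟩ ∈ V) :
    Nonempty (T ≃ₜ* S4 m) := by
  let ψ : S3 →ₙ* T :=
    { toFun := fun x => match x with
        | S3.of c => f c
        | S3.int k => IsBottom.elem f z k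
      map_mul' := by
        rintro (⟨a, b⟩ | k) (⟨c, d⟩ | l)
        · exact map_mul f _ _
        · exact (hz.f_mul_elem h l a b).symm
        · exact (hz.elem_mul_f k c d).symm
        · exact (hz.elem_mul_elem h k l).symm }
  have hne1 : ∀ x, ψ x ≠ 1 := by
    rintro (c | k)
    · exact h.f_ne_one c
    · exact hz.bot_mul_ne_one h _
  have hψ : Function.Injective ψ := by
    rintro (c | k) (d | l) hxy
    · exact congrArg S3.of (h.injective hxy)
    · exact (hz.f_ne_bot_mul h c.fst c.snd _ hxy).elim
    · exact (hz.f_ne_bot_mul h d.fst d.snd _ hxy.symm).elim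
    · exact congrArg S3.int (hz.elem_injective h hunits hxy)
  have hψcases : ∀ x : T, x = 1 ∨ x ∈ Set.range ψ := by
    intro x
    rcases hz.cases h hunits x with ⟨c, rfl⟩ | h1 | h1
    · exact Or.inr ⟨S3.of c, rfl⟩
    · exact Or.inl h1
    · obtain ⟨k, rfl⟩ := hz.eq_elem_of_bot_mul h hunits h1
      exact Or.inr ⟨S3.int k, rfl⟩
  let φ : S4 m →* T := WithOne.lift ψ
  have hφ1 : φ 1 = 1 := map_one φ
  have hφψ : ∀ c, φ (S4.ofS3 c) = ψ c := fun c => WithOne.lift_coe ψ c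
  have hall : ∀ x : S4 m, x = 1 ∨ ∃ c, x = S4.ofS3 c := fun x =>
    WithOne.cases_on (P := fun x => x = (1 : S4 m) ∨ ∃ c, x = S4.ofS3 c) x (Or.inl rfl)
      fun c => Or.inr ⟨c, rfl⟩
  have hall1 : ∀ x : S1 m, x = 1 ∨ ∃ c, x = S1.of c := fun x =>
    WithOne.cases_on (P := fun x => x = (1 : S1 m) ∨ ∃ c, x = S1.of c) x (Or.inl rfl)
      fun c => Or.inr ⟨c, rfl⟩
  have hofS1 : ∀ c, S4.ofS1 (S1.of c : S1 m) = S4.ofS3 (S3.of c) := fun c => rfl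
  have hofS1_one : S4.ofS1 (1 : S1 m) = 1 := rfl
  have hbij : Function.Bijective φ := by
    constructor
    · intro x y hxy
      rcases hall x with rfl | ⟨c, rfl⟩ <;> rcases hall y with rfl | ⟨d, rfl⟩
      · rfl
      · rw [hφ1, hφψ] at hxy
        exact (hne1 d hxy.symm).elim
      · rw [hφ1, hφψ] at hxy
        exact (hne1 c hxy).elim
      · rw [hφψ, hφψ] at hxy
        rw [hψ hxy]
    · intro x
      rcases hψcases x with rfl | ⟨c, rfl⟩
      · exact ⟨1, hφ1⟩
      · exact ⟨_, hφψ c⟩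
  have hcrit : ∀ V : Set T, IsOpen V ↔
      (1 ∈ V → ∃ n : ℕ, ∀ j, n ≤ j → f ⟨m j, m j⟩ ∈ V) ∧
        ∀ k, IsBottom.elem f z k ∈ V → ∃ N : ℤ, ∀ a, N ≤ a → f ⟨a, a + k⟩ ∈ V := by
    intro V
    constructor
    · exact fun hV => ⟨fun h1 => ((hm V).1 (hV.mem_nhds h1)).2,
        fun k hk => ((hz.mem_nhds_elem_iff h hunits k V).1 (hV.mem_nhds hk)).2⟩
    · rintro ⟨h1, h2⟩
      refine (h.isOpen_iff V).2 fun x hxV hxf => ?_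
      rcases hψcases x with rfl | ⟨c | k, rfl⟩
      · exact (hm V).2 ⟨hxV, h1 hxV⟩
      · exact (hxf ⟨c, rfl⟩).elim
      · exact (hz.mem_nhds_elem_iff h hunits k V).2 ⟨hxV, h2 k hxV⟩
  have hmem : ∀ (k : ℤ) (U : Set S3), S3.int k ∈ U →
      ((∃ n : ℕ, 0 < n ∧ S3.intNhd n k ⊆ U) ↔
        ∃ N : ℤ, ∀ a, N ≤ a → S3.of ⟨a, a + k⟩ ∈ U) := by
    intro k U hkU
    unfold S3.intNhd
    constructor
    · rintro ⟨n, -, hn⟩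
      split_ifs at hn with hk
      · exact ⟨n, fun a ha => hn (Or.inr ⟨a, ha, rfl⟩)⟩
      -- For negative `k` the basic set is indexed by the second coordinate `a + k`, which shifts
      -- the threshold by `k`.
      · refine ⟨n - k, fun a ha => hn (Or.inr ⟨a + k, by omega, ?_⟩)⟩
        rw [add_sub_cancel_right]
    · rintro ⟨N, hN⟩
      refine ⟨N.toNat + 1, by omega, ?_⟩
      split_ifs with hk
      · rintro x (rfl | ⟨a, ha, rfl⟩)
        · exact hkU
        · exact hN a (by omega)
      · rintro x (rfl | ⟨a, ha, rfl⟩)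
        · exact hkU
        · have := hN (a - k) (by omega)
          rwa [sub_add_cancel] at this
  let e : S4 m ≃* T := MulEquiv.ofBijective φ hbij
  have hesymm : ∀ x, e.symm (φ x) = x := fun x => e.symm_apply_apply x
  refine ⟨ContinuousMulEquiv.symm ⟨e, ?_, ?_⟩⟩
  · refine continuous_def.2 fun V hV => ?_
    obtain ⟨h1, h2⟩ := (hcrit V).1 hV
    have hU1 : IsOpen ((fun x : S1 m => φ (S4.ofS1 x)) ⁻¹' V) := by
      intro h1V
      have h1V' : φ (S4.ofS1 1) ∈ V := h1V
      rw [hofS1_one, hφ1] at h1V'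
      obtain ⟨n, hn⟩ := h1 h1V'
      refine ⟨n, ?_⟩
      rintro x (rfl | ⟨j, hj, rfl⟩)
      · exact h1V
      · change φ (S4.ofS1 (S1.of _)) ∈ V
        rw [hofS1, hφψ]
        exact hn j hj
    have hU3 : IsOpen (ψ ⁻¹' V) := fun k hk => (hmem k _ hk).2 (h2 k hk)
    have hO1 : IsOpen (S4.ofS1 '' ((fun x : S1 m => φ (S4.ofS1 x)) ⁻¹' V)) :=
      TopologicalSpace.isOpen_generateFrom_of_mem (Or.inl ⟨_, hU1, rfl⟩)
    have hO3 : IsOpen ((S4.ofS3 : S3 → S4 m) '' (ψ ⁻¹' V)) :=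
      TopologicalSpace.isOpen_generateFrom_of_mem (Or.inr ⟨_, hU3, rfl⟩)
    -- Neither piece suffices alone: the first misses the integers and the second misses the unit.
    convert hO1.union hO3
    ext x
    constructor
    · intro hx
      rcases hall x with rfl | ⟨c, rfl⟩
      · exact Or.inl ⟨1, hx, rfl⟩
      · refine Or.inr ⟨c, ?_, rfl⟩
        change ψ c ∈ V
        rw [← hφψ]
        exact hx
    · rintro (⟨y, hy, rfl⟩ | ⟨c, hc, rfl⟩)
      · exact hy
      · change φ _ ∈ V
        rw [hφψ]
        exact hc
  · refine continuous_generateFrom_iff.2 ?_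
    have hpre : ∀ (W : Set (S4 m)) (x : S4 m), φ x ∈ e.symm ⁻¹' W ↔ x ∈ W := fun W x => by
      rw [Set.mem_preimage, hesymm]
    have hone_ne : ∀ c, (S4.ofS3 c : S4 m) ≠ 1 := by
      intro c hc
      apply hne1 c
      rw [← hφψ, hc, hφ1]
    have hofS3_inj : Function.Injective (S4.ofS3 : S3 → S4 m) := by
      intro c d hcd
      apply hψ
      rw [← hφψ, ← hφψ, hcd]
    rintro V (⟨U, hU, rfl⟩ | ⟨U, hU, rfl⟩)
    -- It suffices to test generators. Those from `S1 m` contain no integer, and those from `S3` do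
    -- not contain the unit, so each meets one nontrivial condition.
    · refine (hcrit _).2 ⟨fun h1 => ?_, fun k hk => ?_⟩
      · rw [← hφ1] at h1
        obtain ⟨y, hyU, hy⟩ := (hpre _ _).1 h1
        rcases hall1 y with rfl | ⟨c, rfl⟩
        · obtain ⟨n, hn⟩ := hU hyU
          refine ⟨n, fun j hj => ?_⟩
          have := (hpre (S4.ofS1 '' U) (S4.ofS1 (S1.of ⟨m j, m j⟩))).2
            ⟨_, hn (Or.inr ⟨j, hj, rfl⟩), rfl⟩
          rwa [hofS1, hφψ] at this
        · exact (hone_ne _ hy).elim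
      · have hk' : φ (S4.ofS3 (S3.int k)) ∈ e.symm ⁻¹' (S4.ofS1 '' U) := by
          rw [hφψ]
          exact hk
        obtain ⟨y, hyU, hy⟩ := (hpre _ _).1 hk'
        rcases hall1 y with rfl | ⟨c, rfl⟩
        · exact (hone_ne _ hy.symm).elim
        · exact S3.noConfusion (hofS3_inj hy)
    · refine (hcrit _).2 ⟨fun h1 => ?_, fun k hk => ?_⟩
      · rw [← hφ1] at h1
        obtain ⟨y, hyU, hy⟩ := (hpre _ _).1 h1
        exact (hone_ne _ hy).elim
      · have hk' : φ (S4.ofS3 (S3.int k)) ∈ e.symm ⁻¹' (S4.ofS3 '' U) := by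
          rw [hφψ]
          exact hk
        obtain ⟨y, hyU, hy⟩ := (hpre _ _).1 hk'
        obtain rfl := hofS3_inj hy
        obtain ⟨N, hN⟩ := (hmem k U hyU).1 (hU k hyU)
        refine ⟨N, fun a ha => ?_⟩
        have := (hpre (S4.ofS3 '' U) (S4.ofS3 (S3.of ⟨a, a + k⟩))).2 ⟨_, hN a ha, rfl⟩
        rwa [hφψ] at this

end IsDenseExtBicyclic

theorem mainTheorem9 {T : Type*} [Monoid T] [TopologicalSpace T] [T2Space T]
    [LocallyCompactSpace T] (hT : IsTopologicalInverseSemigroup T)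
    (f : ExtBicyclic →ₙ* T) (hf : Function.Injective f) (hdense : DenseRange f)
    (hunits : ∀ u : Tˣ, u = 1) :
    ∃ m : ℕ → ℤ, StrictAnti m ∧ (∀ i, m i < 0) ∧
      (Nonempty (T ≃ₜ* S1 m) ∨ Nonempty (T ≃ₜ* S4 m)) := by
  have : ContinuousMul T := ⟨hT.continuous_mul⟩
  have h : IsDenseExtBicyclic f hT.isInverse.inversion :=
    { mul_inv_mul := fun x => (hT.isInverse x).choose_spec.1.1
      inv_mul_inv := fun x => (hT.isInverse x).choose_spec.1.2
      eq_inv := fun x y h1 h2 => (hT.isInverse x).choose_spec.2 y ⟨h1, h2⟩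
      continuous_inv := hT.continuous_inversion
      injective := hf
      dense := hdense }
  obtain ⟨m, hm, hneg, hnhds⟩ := h.exists_nhds_one hunits
  refine ⟨m, hm, hneg, ?_⟩
  -- The neighbourhoods of `1` are already described by `m`, so the same sequence serves both cases.
  by_cases hcases : ∀ x : T, x ∈ Set.range f ∨ x = 1
  · exact Or.inl (h.nonempty_equiv_S1 hnhds hcases)
  · push Not at hcases
    obtain ⟨x, hxf, hx1⟩ := hcases
    obtain ⟨z, hz⟩ := h.exists_isBottom hunits hxf hx1
    exact Or.inr (h.nonempty_equiv_S4 hunits hz hnhds)
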